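/- Let $X,Y$ be real locally convex topological vector spaces with topological duals $X^*,Y^*$. For a set-valued mapping $F\colon X\rightrightarrows Y$ put $\operatorname{gph}F=\{(x,y)\in X\times Y: y\in F(x)\}$; $F$ is called convex if $\operatorname{gph}F$ is convex, and polyhedral if $\operatorname{gph}F$ is the solution set of finitely many inequalities $\langle z_i^*,z\rangle\le\alpha_i$ with $z_i^*\in(X\times Y)^*$ and $\alpha_i\in\mathbb R$. For a convex subset $\Omega$ of a locally convex topological vector space, let $\operatorname{qri}(\Omega)$ be the set of all $x\in\Omega$ for which the closure of $\{t(w-x): t\ge 0,\ w\in\Omega\}$ is a linear subspace. For $(\bar x,\bar y)\in\operatorname{gph}F$ and $y^*\in Y^*$ let $$D^*F(\bar x,\bar y)(y^*)=\{x^*\in X^*:\ \langle x^*,x-\bar x\rangle-\langle y^*,y-\bar y\rangle\le 0\ \text{ for all }(x,y)\in\operatorname{gph}F\}.$$ **Theorem.** Let $F_1,F_2\colon X\rightrightarrows Y$ be convex set-valued mappings, let $F_1$ be polyhedral, and suppose that there exist $\hat x\in X$ and $\hat y_1,\hat y_2\in Y$ with $$(\hat x,\hat y_1)\in\operatorname{gph}F_1\quad\text{and}\quad(\hat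 x,\hat y_2)\in\operatorname{qri}(\operatorname{gph}F_2).$$ Let $(F_1+F_2)(x)=\{y_1+y_2: y_1\in F_1(x),\ y_2\in F_2(x)\}$ for $x\in X$. Then $$D^*(F_1+F_2)(\bar x,\bar y)(y^*)=D^*F_1(\bar x,\bar y_1)(y^*)+D^*F_2(\bar x,\bar y_2)(y^*)$$ for all $(\bar x,\bar y)\in\operatorname{gph}(F_1+F_2)$, all $y^*\in Y^*$, and all $\bar y_1\in F_1(\bar x)$, $\bar y_2\in F_2(\bar x)$ with $\bar y=\bar y_1+\bar y_2$. -/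

import Mathlib

open scoped Pointwise

namespace SetValued

section Sets

variable {E : Type*} [AddCommGroup E] [Module ℝ E]

/-- The conic hull `cone(A) = {t a | t ≥ 0, a ∈ A}`. -/
def conicHull (A : Set E) : Set E :=
  {z | ∃ t : ℝ, 0 ≤ t ∧ ∃ a ∈ A, z = t • a}

variable [TopologicalSpace E]

/-- The quasi-relative interior of `Ω`: the points `x ∈ Ω` for which the closure of
`cone(Ω - x)` is a linear subspace of `E`. -/
def quasiRelInterior (Ω : Set E) : Set E :=
  {x | x ∈ Ω ∧ ∃ S : Submodule ℝ E, (S : Set E) = closure (conicHull {z | ∃ w ∈ Ω, z = w - x})}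

/-- `P` is a polyhedral set (convex polyhedron): the solution set of finitely many inequalities
`⟨f i, x⟩ ≤ α i` with continuous linear functionals `f i`. -/
def IsPolyhedralSet (P : Set E) : Prop :=
  ∃ (k : ℕ) (f : Fin k → (E →L[ℝ] ℝ)) (α : Fin k → ℝ), P = {x | ∀ i, f i x ≤ α i}

/-- The normal cone to `Ω` at `x₀`; it is empty if `x₀ ∉ Ω`. -/
def normalCone (x₀ : E) (Ω : Set E) : Set (E →L[ℝ] ℝ) :=
  {f | x₀ ∈ Ω ∧ ∀ x ∈ Ω, f (x - x₀) ≤ 0}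

end Sets

section Maps

variable {X Y : Type*}

/-- The graph of a set-valued mapping `F : X ⇉ Y`. -/
def gph (F : X → Set Y) : Set (X × Y) := {p | p.2 ∈ F p.1}

/-- The (Minkowski) sum of two set-valued mappings. -/
def sum [Add Y] (F₁ F₂ : X → Set Y) : X → Set Y :=
  fun x => {y | ∃ y₁ ∈ F₁ x, ∃ y₂ ∈ F₂ x, y = y₁ + y₂}

/-- The set `S(x₀, y₀)` of splittings `y₀ = y₁ + y₂` with `y₁ ∈ F₁ x₀` and `y₂ ∈ F₂ x₀`. -/
def splittings [Add Y] (F₁ F₂ : X → Set Y) (x₀ : X) (y₀ : Y) : Set (Y × Y) :=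
  {q | y₀ = q.1 + q.2 ∧ q.1 ∈ F₁ x₀ ∧ q.2 ∈ F₂ x₀}

variable [AddCommGroup X] [Module ℝ X] [AddCommGroup Y] [Module ℝ Y]

/-- A set-valued mapping is convex if its graph is a convex set. -/
def IsConvexMap (F : X → Set Y) : Prop := Convex ℝ (gph F)

variable [TopologicalSpace X] [TopologicalSpace Y]

/-- A set-valued mapping is polyhedral if its graph is a convex polyhedron in `X × Y`. -/
def IsPolyhedralMap (F : X → Set Y) : Prop := IsPolyhedralSet (gph F)

/-- The coderivative `D*F(x₀, y₀)(g) = {f | (f, -g) ∈ N((x₀, y₀); gph F)}`, where the pair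
`(f, -g)` is the functional `(x, y) ↦ f x - g y` on `X × Y`. -/
def coderivative (F : X → Set Y) (x₀ : X) (y₀ : Y) (g : Y →L[ℝ] ℝ) : Set (X →L[ℝ] ℝ) :=
  {f | f.coprod (-g) ∈ normalCone (x₀, y₀) (gph F)}

end Maps

end SetValued

/-!
The sum rule is a Lagrange multiplier theorem for affine constraints. If `f ∈ D*(F₁ + F₂)(x₀, y₀)(g)`,
then on `X × Y × Y` the functional `(x, y₁, y₂) ↦ f x - g y₁ - g y₂` is at most its value at
`(x₀, z₁, z₂)` on `Ω ∩ P`, where `Ω = {(x, y₁, y₂) | y₂ ∈ F₂ x}` and the polyhedron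
`P = {(x, y₁, y₂) | y₁ ∈ F₁ x}` is given by finitely many affine constraints. Multipliers `c i ≥ 0`
for these constraints (`IsNonsupportPoint.exists_multipliers`) split the functional: the
combination `∑ i, c i • a i` of the constraint functionals is normal to `gph F₁`, and what remains
is normal to `gph F₂`.

The only consequence of quasi-relative interiority used for the multipliers is that a continuous
linear functional minimized over `Ω` at the given point is constant on `Ω` (`IsNonsupportPoint`).
This allows an induction on the number of constraints, without passing to finite dimension. Let
`h ≤ α` be the constraint to be eliminated. If some nonsupport point satisfying all the constraints
has `h < α`, it remains a nonsupport point of `Ω ∩ {h ≤ α}`. Otherwise `h = α` at the given point,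
which remains a nonsupport point of `Ω ∩ {h = α}`. In this second case the multiplier of `h` may come
out negative; but then `h ≥ α` whenever the remaining constraints hold on `Ω`, and the induction
hypothesis bounds `α - h` by a nonnegative combination of the remaining constraints. In both cases
the multiplier of `h` comes from separation in the plane
(`Convex.exists_le_mul_sub_of_level`).
-/

namespace SetValued

section Multipliers

variable {E : Type*} [AddCommGroup E] [Module ℝ E] [TopologicalSpace E]

/-! ### Separation along one functional -/

/-- If `φ ≤ β` on the level set `{h = α}` of a convex set, and `h` takes values on both sides of `α`,
then `φ - β` is bounded by a multiple of `h - α`. -/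
theorem _root_.Convex.exists_le_mul_sub_of_level {Ω : Set E} (hΩ : Convex ℝ Ω) {h φ : E →L[ℝ] ℝ}
    {α β : ℝ} {a b : E} (ha : a ∈ Ω) (haα : h a < α) (hb : b ∈ Ω) (hbα : α < h b)
    (hφ : ∀ w ∈ Ω, h w = α → φ w ≤ β) :
    ∃ μ : ℝ, ∀ w ∈ Ω, φ w - β ≤ μ * (h w - α) := by
  -- the segment from `u` to `v` meets the level set, where `φ ≤ β`
  have key : ∀ u ∈ Ω, h u < α → ∀ v ∈ Ω, α < h v →
      (φ v - β) / (h v - α) ≤ (φ u - β) / (h u - α) := by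
    intro u hu huα v hv hvα
    have hd : 0 < h v - h u := by linarith
    have hmem := hΩ hu hv (a := (h v - α) / (h v - h u)) (b := (α - h u) / (h v - h u))
      (div_nonneg (by linarith) hd.le) (div_nonneg (by linarith) hd.le)
      (by field_simp; ring)
    have hle := hφ _ hmem (by
      simp only [map_add, map_smul, smul_eq_mul]
      field_simp
      ring)
    simp only [map_add, map_smul, smul_eq_mul] at hle
    have hle' : (h v - α) * φ u + (α - h u) * φ v ≤ β * (h v - h u) := by
      rw [← div_le_iff₀ hd]
      refine le_of_eq_of_le ?_ hle
      ring
    rw [← neg_div_neg_eq (φ u - β), div_le_div_iff₀ (by linarith) (by linarith)]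
    nlinarith
  refine ⟨sSup {r | ∃ v ∈ Ω, α < h v ∧ r = (φ v - β) / (h v - α)}, fun w hw => ?_⟩
  rcases lt_trichotomy (h w) α with hlt | heq | hgt
  · have : sSup {r | ∃ v ∈ Ω, α < h v ∧ r = (φ v - β) / (h v - α)} ≤ (φ w - β) / (h w - α) := by
      refine csSup_le ⟨_, b, hb, hbα, rfl⟩ ?_
      rintro r ⟨v, hv, hvα, rfl⟩
      exact key w hw hlt v hv hvα
    exact (le_div_iff_of_neg (by linarith)).1 this
  · have := hφ w hw heq
    rw [heq]
    linarith
  · rw [← div_le_iff₀ (by linarith)]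
    refine le_csSup ⟨(φ a - β) / (h a - α), ?_⟩ ⟨w, hw, hgt, rfl⟩
    rintro r ⟨v, hv, hvα, rfl⟩
    exact key a ha haα v hv hvα

/-! ### Nonsupport points -/

/-- A point `x ∈ Ω` is a nonsupport point if every continuous linear functional that attains its
minimum over `Ω` at `x` is constant on `Ω`. -/
def IsNonsupportPoint (Ω : Set E) (x : E) : Prop :=
  x ∈ Ω ∧ ∀ l : E →L[ℝ] ℝ, (∀ w ∈ Ω, l x ≤ l w) → ∀ w ∈ Ω, l w = l x

theorem isNonsupportPoint_of_mem_quasiRelInterior {Ω : Set E} {x : E}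
    (hx : x ∈ quasiRelInterior Ω) : IsNonsupportPoint Ω x := by
  obtain ⟨hxΩ, S, hS⟩ := hx
  refine ⟨hxΩ, fun l hl w hw => ?_⟩
  have hnonneg : ∀ z ∈ S, 0 ≤ l z := by
    intro z hz
    have hz' : z ∈ closure (conicHull {z | ∃ w ∈ Ω, z = w - x}) := hS ▸ hz
    refine closure_minimal ?_ (isClosed_le continuous_const l.continuous) hz'
    rintro _ ⟨t, ht, _, ⟨v, hv, rfl⟩, rfl⟩
    have := hl v hv
    simpa using mul_nonneg ht (sub_nonneg.2 this)
  have hwS : w - x ∈ S := by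
    change w - x ∈ (S : Set E)
    rw [hS]
    exact subset_closure ⟨1, zero_le_one, w - x, ⟨w, hw, rfl⟩, (one_smul ℝ _).symm⟩
  have h1 := hnonneg _ hwS
  have h2 := hnonneg _ (S.neg_mem hwS)
  simp only [map_neg, map_sub] at h1 h2
  linarith

namespace IsNonsupportPoint

variable {Ω : Set E} {x : E}

theorem midpoint (hΩ : Convex ℝ Ω) (hx : IsNonsupportPoint Ω x) {w : E} (hw : w ∈ Ω) :
    IsNonsupportPoint Ω ((1 / 2 : ℝ) • x + (1 / 2 : ℝ) • w) := by
  refine ⟨hΩ hx.1 hw (by norm_num) (by norm_num) (by norm_num), fun l hl v hv => ?_⟩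
  simp only [map_add, map_smul, smul_eq_mul] at hl ⊢
  have h1 := hl x hx.1
  have h2 := hl w hw
  have hmin : ∀ u ∈ Ω, l x ≤ l u := fun u hu => by linarith [hl u hu]
  linarith [hx.2 l hmin v hv, hx.2 l hmin w hw]

theorem inter_setOf_le (hΩ : Convex ℝ Ω) (hx : IsNonsupportPoint Ω x) {h : E →L[ℝ] ℝ} {α : ℝ}
    (hxα : h x < α) : IsNonsupportPoint (Ω ∩ {w | h w ≤ α}) x := by
  refine ⟨⟨hx.1, hxα.le⟩, fun l hl w hw => hx.2 l (fun v hv => ?_) w hw.1⟩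
  -- a short step from `x` towards `v` stays in `{h ≤ α}`
  obtain ⟨t, ht0, ht1, ht⟩ : ∃ t : ℝ, 0 < t ∧ t ≤ 1 ∧ t * (h v - h x) ≤ α - h x := by
    have hd : 0 < α - h x + |h v - h x| := by positivity [sub_pos.2 hxα]
    refine ⟨(α - h x) / (α - h x + |h v - h x|), div_pos (sub_pos.2 hxα) hd,
      (div_le_one hd).2 (by linarith [abs_nonneg (h v - h x)]), ?_⟩
    rw [div_mul_eq_mul_div, div_le_iff₀ hd]
    exact mul_le_mul_of_nonneg_left (by linarith [le_abs_self (h v - h x)]) (sub_pos.2 hxα).le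
  have hmem := hΩ hx.1 hv (a := 1 - t) (b := t) (by linarith) ht0.le (by ring)
  have hle := hl _ ⟨hmem, by
    simp only [Set.mem_ofPred_eq, map_add, map_smul, smul_eq_mul]
    linarith⟩
  simp only [map_add, map_smul, smul_eq_mul] at hle
  have : 0 ≤ t * (l v - l x) := by linarith
  linarith [nonneg_of_mul_nonneg_right this ht0]

/-- At a nonsupport point, a functional is either constant on `Ω` or takes values on both sides. -/
theorem eq_or_exists_lt_and_gt (hx : IsNonsupportPoint Ω x) (h : E →L[ℝ] ℝ) :
    (∀ w ∈ Ω, h w = h x) ∨ (∃ a ∈ Ω, h a < h x) ∧ ∃ b ∈ Ω, h x < h b := by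
  by_cases ha : ∃ a ∈ Ω, h a < h x
  · by_cases hb : ∃ b ∈ Ω, h x < h b
    · exact Or.inr ⟨ha, hb⟩
    · push Not at hb
      refine Or.inl fun w hw => ?_
      simpa using hx.2 (-h) (fun v hv => by simpa using hb v hv) w hw
  · push Not at ha
    exact Or.inl (hx.2 h ha)

theorem exists_le_mul_sub (hΩ : Convex ℝ Ω) (hx : IsNonsupportPoint Ω x) {h φ : E →L[ℝ] ℝ} {β : ℝ}
    (hφ : ∀ w ∈ Ω, h w = h x → φ w ≤ β) :
    ∃ μ : ℝ, ∀ w ∈ Ω, φ w - β ≤ μ * (h w - h x) := by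
  rcases hx.eq_or_exists_lt_and_gt h with hc | ⟨⟨a, ha, haα⟩, b, hb, hbα⟩
  · exact ⟨0, fun w hw => by linarith [hφ w hw (hc w hw)]⟩
  · exact hΩ.exists_le_mul_sub_of_level ha haα hb hbα hφ

theorem inter_setOf_eq (hΩ : Convex ℝ Ω) (hx : IsNonsupportPoint Ω x) (h : E →L[ℝ] ℝ) :
    IsNonsupportPoint (Ω ∩ {w | h w = h x}) x := by
  refine ⟨⟨hx.1, rfl⟩, fun l hl w hw => ?_⟩
  -- `l + μ • h` is minimized over all of `Ω` at `x`, for a suitable `μ`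
  obtain ⟨μ, hμ⟩ := hx.exists_le_mul_sub hΩ (h := h) (φ := -l) (β := -l x)
    (fun v hv hvα => neg_le_neg (hl v ⟨hv, hvα⟩))
  have := hx.2 (l + μ • h) (fun v hv => by
    have := hμ v hv
    simp only [neg_apply, add_apply,
      smul_apply, smul_eq_mul] at this ⊢
    linarith) w hw.1
  have hw2 : h w = h x := hw.2
  simp only [add_apply, smul_apply, hw2] at this
  linarith

/-! ### Lagrange multipliers for affine constraints -/

/-- Lagrange multipliers exist for finitely many affine constraints that hold, not necessarily
strictly, at some nonsupport point of `Ω`. -/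
theorem exists_multipliers {n : ℕ} {a : Fin n → E →L[ℝ] ℝ} {α : Fin n → ℝ}
    {φ : E →L[ℝ] ℝ} {β : ℝ} (hΩ : Convex ℝ Ω) (hx : IsNonsupportPoint Ω x)
    (hxα : ∀ i, a i x ≤ α i) (hφ : ∀ w ∈ Ω, (∀ i, a i w ≤ α i) → φ w ≤ β) :
    ∃ c : Fin n → ℝ, (∀ i, 0 ≤ c i) ∧ ∀ w ∈ Ω, φ w - β ≤ ∑ i, c i * (a i w - α i) := by
  induction n generalizing Ω x φ β with
  | zero => exact ⟨0, fun i => i.elim0, fun w hw => by simpa using hφ w hw fun i => i.elim0⟩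
  | succ n ih =>
    -- the multipliers `c` of the remaining constraints enter through this functional
    have hψ : ∀ (c : Fin n → ℝ) (w : E), (φ - ∑ i, c i • a i.succ) w
        - (β - ∑ i, c i * α i.succ) = φ w - β - ∑ i, c i * (a i.succ w - α i.succ) := by
      intro c w
      simp only [sub_apply, sum_apply,
        smul_apply, smul_eq_mul, mul_sub, Finset.sum_sub_distrib]
      ring
    by_cases hstrict : ∃ z, IsNonsupportPoint Ω z ∧ (∀ i, a i z ≤ α i) ∧ a 0 z < α 0
    · obtain ⟨z, hz, hzα, hz0⟩ := hstrict
      obtain ⟨c, hc, hcle⟩ := ih (a := fun i => a i.succ) (α := fun i => α i.succ)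
        (hΩ.inter (convex_halfSpace_le (a 0).isLinear (α 0))) (hz.inter_setOf_le hΩ hz0)
        (fun i => hzα i.succ) (fun w hw hwα => hφ w hw.1 (Fin.forall_fin_succ.2 ⟨hw.2, hwα⟩))
      obtain ⟨μ, hμ0, hμ⟩ : ∃ μ : ℝ, 0 ≤ μ ∧ ∀ w ∈ Ω,
          φ w - β - ∑ i, c i * (a i.succ w - α i.succ) ≤ μ * (a 0 w - α 0) := by
        by_cases hb : ∃ b ∈ Ω, α 0 < a 0 b
        · obtain ⟨b, hb, hbα⟩ := hb
          obtain ⟨μ, hμ⟩ := hΩ.exists_le_mul_sub_of_level (φ := φ - ∑ i, c i • a i.succ)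
            (β := β - ∑ i, c i * α i.succ) hz.1 hz0 hb hbα
            (fun w hw hw0 => by linarith [hψ c w, hcle w ⟨hw, hw0.le⟩])
          -- on `{a 0 ≤ α 0}` the multiplier `0` works; elsewhere the multiplier may be enlarged
          rcases le_total 0 μ with h0 | h0
          · exact ⟨μ, h0, fun w hw => hψ c w ▸ hμ w hw⟩
          · refine ⟨0, le_rfl, fun w hw => ?_⟩
            rcases le_total (a 0 w) (α 0) with hw0 | hw0
            · linarith [hcle w ⟨hw, hw0⟩]
            · linarith [hψ c w, hμ w hw, mul_nonpos_of_nonpos_of_nonneg h0 (sub_nonneg.2 hw0)]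
        · push Not at hb
          exact ⟨0, le_rfl, fun w hw => by linarith [hcle w ⟨hw, hb w hw⟩]⟩
      refine ⟨Fin.cons μ c, Fin.forall_fin_succ.2 ⟨hμ0, hc⟩, fun w hw => ?_⟩
      rw [Fin.sum_univ_succ]
      simp only [Fin.cons_zero, Fin.cons_succ]
      linarith [hμ w hw]
    · push Not at hstrict
      have hx0 : a 0 x = α 0 := le_antisymm (hxα 0) (hstrict x hx hxα)
      obtain ⟨c, hc, hcle⟩ := ih (a := fun i => a i.succ) (α := fun i => α i.succ)
        (hΩ.inter (convex_hyperplane (a 0).isLinear (a 0 x))) (hx.inter_setOf_eq hΩ (a 0))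
        (fun i => hxα i.succ)
        (fun w hw hwα => hφ w hw.1 (Fin.forall_fin_succ.2 ⟨(hw.2.trans hx0).le, hwα⟩))
      obtain ⟨μ, hμ⟩ := hx.exists_le_mul_sub hΩ (h := a 0) (φ := φ - ∑ i, c i • a i.succ)
        (β := β - ∑ i, c i * α i.succ)
        (fun w hw hw0 => by linarith [hψ c w, hcle w ⟨hw, hw0⟩])
      simp only [hψ, hx0] at hμ
      rcases le_total 0 μ with h0 | h0
      · refine ⟨Fin.cons μ c, Fin.forall_fin_succ.2 ⟨h0, hc⟩, fun w hw => ?_⟩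
        rw [Fin.sum_univ_succ]
        simp only [Fin.cons_zero, Fin.cons_succ]
        linarith [hμ w hw]
      · obtain ⟨d, hd, hdle⟩ := ih (a := fun i => a i.succ) (α := fun i => α i.succ)
          (φ := -a 0) (β := -α 0) hΩ hx (fun i => hxα i.succ) (fun w hw hwα => by
            -- otherwise the midpoint of `x` and `w` would be a strict nonsupport point
            by_contra hlt
            have hlt' : a 0 w < α 0 := by simpa using hlt
            have hall : ∀ i, a i w ≤ α i := Fin.forall_fin_succ.2 ⟨hlt'.le, hwα⟩
            have := hstrict _ (hx.midpoint hΩ hw) (fun i => by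
              simp only [map_add, map_smul, smul_eq_mul]
              linarith [hall i, hxα i])
            simp only [map_add, map_smul, smul_eq_mul] at this
            linarith)
        refine ⟨Fin.cons 0 fun i => c i + (-μ) * d i, Fin.forall_fin_succ.2 ⟨le_rfl, fun i => ?_⟩,
          fun w hw => ?_⟩
        · exact add_nonneg (hc i) (mul_nonneg (neg_nonneg.2 h0) (hd i))
        · have h1 := hμ w hw
          have h2 := mul_le_mul_of_nonneg_left (hdle w hw) (neg_nonneg.2 h0)
          rw [Fin.sum_univ_succ]
          simp only [Fin.cons_zero, Fin.cons_succ, add_mul, Finset.sum_add_distrib, mul_assoc,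
            ← Finset.mul_sum, neg_apply] at h2 ⊢
          linarith

end IsNonsupportPoint

end Multipliers

/-! ### The sum rule for coderivatives -/

section SumRule

variable {X Y : Type*} [AddCommGroup X] [Module ℝ X] [TopologicalSpace X]
  [AddCommGroup Y] [Module ℝ Y] [TopologicalSpace Y]

theorem mem_coderivative {F : X → Set Y} {x₀ : X} {y₀ : Y} {g : Y →L[ℝ] ℝ} {f : X →L[ℝ] ℝ} :
    f ∈ coderivative F x₀ y₀ g ↔
      y₀ ∈ F x₀ ∧ ∀ x, ∀ y ∈ F x, f x - g y ≤ f x₀ - g y₀ := by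
  simp only [coderivative, normalCone, gph, Set.mem_ofPred_eq, Prod.forall,
    ContinuousLinearMap.coprod_apply, neg_apply, map_sub]
  refine and_congr_right fun _ => forall_congr' fun x => forall_congr' fun y =>
    imp_congr_right fun _ => ?_
  constructor <;> intro h <;> linarith

/-- A functional bounded above is zero. -/
theorem eq_zero_of_forall_le {E : Type*} [AddCommGroup E] [Module ℝ E]
    {l : E →ₗ[ℝ] ℝ} {C : ℝ} (hl : ∀ y, l y ≤ C) : l = 0 := by
  ext y
  by_contra hy
  have hy' : l y ≠ 0 := hy
  have := hl (((C + 1) / l y) • y)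
  rw [map_smul, smul_eq_mul, div_mul_cancel₀ _ hy'] at this
  linarith

/-- The set `{(x, y₁, y₂) | y₂ ∈ F x}` is, up to a free coordinate, the graph of `F`; a nonsupport
point of the graph remains one whatever the value of the free coordinate. -/
theorem IsNonsupportPoint.comap_graph {F : X → Set Y} {x : X} {y₂ : Y}
    (h : IsNonsupportPoint (gph F) (x, y₂)) (y₁ : Y) :
    IsNonsupportPoint {p : X × Y × Y | p.2.2 ∈ F p.1} (x, y₁, y₂) := by
  refine ⟨h.1, fun l hl => ?_⟩
  have hsplit : ∀ u v w, l (u, v, w) = l (u, 0, w) + l (0, v, 0) := by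
    intro u v w
    rw [← map_add]
    simp
  have hfree : ∀ v, l (0, v, 0) = 0 := by
    have := eq_zero_of_forall_le (C := -l (0, y₁, 0) + l (0, 0, 0))
      (l := -(l.toLinearMap ∘ₗ LinearMap.inr ℝ X (Y × Y) ∘ₗ LinearMap.inl ℝ Y Y)) fun v => by
        have := hl (x, v, y₂) h.1
        rw [hsplit x v, hsplit x y₁] at this
        have h0 : l (0, 0, 0) = 0 := map_zero l
        simp only [LinearMap.neg_apply, LinearMap.comp_apply, LinearMap.inl_apply,
          LinearMap.inr_apply, ContinuousLinearMap.coe_coe]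
        linarith
    intro v
    have := LinearMap.congr_fun this v
    simpa using this
  have hval : ∀ u v w, l (u, v, w) = l (u, 0, w) := fun u v w => by
    rw [hsplit, hfree, add_zero]
  have key := h.2 (l.comp ((ContinuousLinearMap.fst ℝ X Y).prod
    ((0 : X × Y →L[ℝ] Y).prod (ContinuousLinearMap.snd ℝ X Y))))
  simp only [Prod.forall, ContinuousLinearMap.comp_apply, ContinuousLinearMap.prod_apply,
    ContinuousLinearMap.coe_fst', ContinuousLinearMap.coe_snd',
    zero_apply] at key
  rintro ⟨u, v, w⟩ hw
  rw [hval u, hval x]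
  refine key (fun u w hw => ?_) u w hw
  rw [← hval u 0, ← hval x y₁]
  exact hl (u, 0, w) hw

/-- The easy inclusion of the sum rule, which needs neither convexity nor a qualification
condition. -/
theorem coderivative_add_subset {F₁ F₂ : X → Set Y} {x₀ : X} {z₁ z₂ : Y} {g : Y →L[ℝ] ℝ} :
    coderivative F₁ x₀ z₁ g + coderivative F₂ x₀ z₂ g ⊆
      coderivative (sum F₁ F₂) x₀ (z₁ + z₂) g := by
  rintro _ ⟨p, hp, q, hq, rfl⟩
  rw [mem_coderivative] at hp hq
  refine mem_coderivative.2 ⟨⟨z₁, hp.1, z₂, hq.1, rfl⟩, ?_⟩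
  rintro x _ ⟨y₁, hy₁, y₂, hy₂, rfl⟩
  have h1 := hp.2 x y₁ hy₁
  have h2 := hq.2 x y₂ hy₂
  simp only [add_apply, map_add]
  linarith

/-- The inclusion of the sum rule that needs multipliers: the part of the functional assigned to
`F₁` is the combination `A` of the constraint functionals of `gph F₁`. -/
theorem coderivative_sum_subset {F₁ F₂ : X → Set Y} (hF₂ : IsConvexMap F₂)
    (hP : IsPolyhedralMap F₁) {x : X} {y₁ y₂ : Y} (hy₁ : (x, y₁) ∈ gph F₁)
    (hy₂ : IsNonsupportPoint (gph F₂) (x, y₂)) {x₀ : X} {z₁ z₂ : Y} (hz₁ : z₁ ∈ F₁ x₀)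
    (hz₂ : z₂ ∈ F₂ x₀) {g : Y →L[ℝ] ℝ} :
    coderivative (sum F₁ F₂) x₀ (z₁ + z₂) g ⊆
      coderivative F₁ x₀ z₁ g + coderivative F₂ x₀ z₂ g := by
  intro f hf
  have hfle := (mem_coderivative.1 hf).2
  obtain ⟨k, a, α, hP⟩ := hP
  have hmem : ∀ u v, v ∈ F₁ u ↔ ∀ i, a i (u, v) ≤ α i := fun u v => Set.ext_iff.1 hP (u, v)
  have hconv : Convex ℝ {p : X × Y × Y | p.2.2 ∈ F₂ p.1} := by
    intro p hp q hq s t hs ht hst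
    exact hF₂ (x := (p.1, p.2.2)) hp (y := (q.1, q.2.2)) hq hs ht hst
  obtain ⟨c, hc, hcle⟩ := (hy₂.comap_graph y₁).exists_multipliers hconv
    (a := fun i => (a i).comp ((ContinuousLinearMap.fst ℝ X (Y × Y)).prod
      ((ContinuousLinearMap.fst ℝ Y Y).comp (ContinuousLinearMap.snd ℝ X (Y × Y)))))
    (α := α) (φ := f.coprod ((-g).coprod (-g))) (β := f x₀ - g (z₁ + z₂))
    ((hmem x y₁).1 hy₁) (by
      rintro ⟨u, v, w⟩ hw hv
      have := hfle u (v + w) ⟨v, (hmem u v).2 hv, w, hw, rfl⟩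
      simp only [ContinuousLinearMap.coprod_apply, neg_apply, map_add]
        at this ⊢
      linarith)
  set A : X × Y →L[ℝ] ℝ := ∑ i, c i • a i with hA
  have hsum : ∀ u v, ∑ i, c i * (a i (u, v) - α i) = A (u, v) - ∑ i, c i * α i := by
    intro u v
    simp [hA, mul_sub, Finset.sum_sub_distrib]
  have hmain : ∀ u v w, w ∈ F₂ u →
      f u - g v - g w - (f x₀ - g z₁ - g z₂) ≤ A (u, v) - ∑ i, c i * α i := by
    intro u v w hw
    have := hcle (u, v, w) hw
    simp only [ContinuousLinearMap.coprod_apply, neg_apply, map_add,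
      ContinuousLinearMap.comp_apply, ContinuousLinearMap.prod_apply,
      ContinuousLinearMap.coe_fst', ContinuousLinearMap.coe_snd', hsum] at this
    linarith
  have hAle : ∀ u v, v ∈ F₁ u → A (u, v) ≤ ∑ i, c i * α i := by
    intro u v hv
    rw [← sub_nonpos, ← hsum]
    exact Finset.sum_nonpos fun i _ =>
      mul_nonpos_of_nonneg_of_nonpos (hc i) (sub_nonpos.2 ((hmem u v).1 hv i))
  -- complementary slackness
  have hAeq : A (x₀, z₁) = ∑ i, c i * α i :=
    le_antisymm (hAle x₀ z₁ hz₁) (by linarith [hmain x₀ z₁ z₂ hz₂])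
  have hAsplit : ∀ u v, A (u, v) = A (u, 0) + A (0, v) := by
    intro u v
    rw [← map_add]
    simp
  -- the coordinate `y₁` is free in `hmain`
  have hAg : ∀ v, A (0, v) = -g v := by
    have := eq_zero_of_forall_le (C := A (x₀, 0) - ∑ i, c i * α i - g z₁)
      (l := -(A.toLinearMap ∘ₗ LinearMap.inr ℝ X Y) - g.toLinearMap) fun v => by
        have := hmain x₀ v z₂ hz₂
        rw [hAsplit] at this
        simp only [LinearMap.sub_apply, LinearMap.neg_apply, LinearMap.comp_apply,
          LinearMap.inr_apply, ContinuousLinearMap.coe_coe]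
        linarith
    intro v
    have := LinearMap.congr_fun this v
    simp only [LinearMap.sub_apply, LinearMap.neg_apply, LinearMap.comp_apply,
      LinearMap.inr_apply, ContinuousLinearMap.coe_coe, LinearMap.zero_apply] at this
    linarith
  set p : X →L[ℝ] ℝ := A.comp (ContinuousLinearMap.inl ℝ X Y) with hp
  have hAp : ∀ u v, A (u, v) = p u - g v := by
    intro u v
    rw [hAsplit, hAg, hp, ContinuousLinearMap.comp_apply, ContinuousLinearMap.inl_apply]
    ring
  simp only [hAp] at hmain hAle hAeq
  refine ⟨p, mem_coderivative.2 ⟨hz₁, fun u v hv => ?_⟩, f - p,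
    mem_coderivative.2 ⟨hz₂, fun u w hw => ?_⟩, add_sub_cancel p f⟩
  · exact hAeq ▸ hAle u v hv
  · have := hmain u 0 w hw
    simp only [map_zero, sub_apply] at this ⊢
    linarith

end SumRule

end SetValued

theorem theorem5p2
    {X Y : Type*}
    [AddCommGroup X] [Module ℝ X] [TopologicalSpace X] [IsTopologicalAddGroup X]
    [ContinuousSMul ℝ X] [LocallyConvexSpace ℝ X]
    [AddCommGroup Y] [Module ℝ Y] [TopologicalSpace Y] [IsTopologicalAddGroup Y]
    [ContinuousSMul ℝ Y] [LocallyConvexSpace ℝ Y]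
    (F₁ F₂ : X → Set Y)
    (hF₁ : SetValued.IsConvexMap F₁) (hF₂ : SetValued.IsConvexMap F₂)
    (hP : SetValued.IsPolyhedralMap F₁)
    (hQ : ∃ (x : X) (y₁ y₂ : Y), (x, y₁) ∈ SetValued.gph F₁ ∧
      (x, y₂) ∈ SetValued.quasiRelInterior (SetValued.gph F₂))
    (x₀ : X) (y₀ : Y) (h₀ : (x₀, y₀) ∈ SetValued.gph (SetValued.sum F₁ F₂))
    (g : Y →L[ℝ] ℝ)
    (z₁ z₂ : Y) (hz : (z₁, z₂) ∈ SetValued.splittings F₁ F₂ x₀ y₀) :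
    SetValued.coderivative (SetValued.sum F₁ F₂) x₀ y₀ g =
      SetValued.coderivative F₁ x₀ z₁ g + SetValued.coderivative F₂ x₀ z₂ g := by
  obtain ⟨x, y₁, y₂, hy₁, hy₂⟩ := hQ
  obtain ⟨rfl, hz₁, hz₂⟩ := hz
  exact Set.Subset.antisymm
    (SetValued.coderivative_sum_subset hF₂ hP hy₁
      (SetValued.isNonsupportPoint_of_mem_quasiRelInterior hy₂) hz₁ hz₂)
    SetValued.coderivative_add_subset
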